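/- Let $L$ be a number field with absolute Galois group $G_L=\mathrm{Gal}(\overline{L}/L)$, let $p$ be a prime number, let $K$ be a finite extension of $\mathbf{Q}_p$, and let $m\ge 0$ be an integer. Let $\rho : G_L \to GL_m(K)$ be a continuous homomorphism such that the representation of $G_L$ on $K^m$ is semisimple and the image $\rho(G_L)$ is abelian. Then $\rho$ is ramified at only finitely many primes of $L$: for all but finitely many nonzero prime ideals $\mathfrak{q}$ of the ring of integers of $L$, the inertia group of every prime above $\mathfrak{q}$ in the ring of algebraic integers of $\overline{L}$ is contained in the kernel of $\rho$. -/

import Mathlib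

open scoped NumberField MatrixGroups

noncomputable section

/-- The absolute Galois group `G_L` of a field `L` (with the Krull topology). -/
abbrev AbsGal (L : Type*) [Field L] : Type _ := Gal(AlgebraicClosure L/L)

/-- The ring of all algebraic integers in the algebraic closure of `L`. -/
abbrev AlgInt (L : Type*) [Field L] : Type _ := 𝓞 (AlgebraicClosure L)

/-- The linear representation on `K ^ m` attached to a homomorphism into `GL_m(K)`. -/
def linearRep {G K : Type*} [Group G] [Field K] {m : ℕ} (ρ : G →* GL (Fin m) K) :
    Representation K G (Fin m → K) :=
  (Matrix.toLinAlgEquiv' (R := K) (n := Fin m) : _ →* _).comp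
    ((Units.coeHom (Matrix (Fin m) (Fin m) K)).comp ρ)

/-- `ρ` is unramified at the nonzero prime `q` of `L`: the inertia group
`{σ | ∀ x, σ x - x ∈ Q}` of every prime `Q` above `q` in the ring of algebraic integers of
the algebraic closure lies in the kernel of `ρ`. -/
def IsUnramifiedAt {L H : Type*} [Field L] [NumberField L] [Group H] (ρ : AbsGal L →* H)
    (q : IsDedekindDomain.HeightOneSpectrum (𝓞 L)) : Prop :=
  ∀ Q : Ideal (AlgInt L), Q.IsPrime → Q.LiesOver q.asIdeal → Q.inertia (AbsGal L) ≤ ρ.ker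

end

/-! Tame inertia in an abelian extension is finite of order dividing `c - 1`, where `c` is the
residue cardinality below, whereas small subgroups of `GL_m(K)` are pro-`p` and torsion-free. Let
`L'` be the finite extension cut out by a small congruence subgroup. Discard the primes above `p`
and those with nontrivial inertia in `L'`. If `σ` is an inertia element at a remaining prime, `ρ σ`
lies in the small subgroup (`exists_pow_prime_pow_mem_normCongruenceSubgroup` and
`eq_one_of_pow_eq_one_of_mem_normCongruenceSubgroup` describe it). In each finite layer `M` cut out
by a congruence subgroup, `σ` has `p`-power order, so it is tame; commuting with Frobenius forces
its order to divide `c - 1` (`NumberField.pow_card_sub_one_eq_one_of_mem_inertia`). Letting the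
radius shrink gives `ρ σ ^ (c - 1) = 1`, and torsion-freeness gives `ρ σ = 1`. -/

/-! ### Tame inertia in Dedekind domains -/

/-- The ring-theoretic input on higher ramification: an automorphism of finite order `N` that acts
trivially modulo `Q` and on `Q / Q ^ 2` is trivial when `N` is not in `Q`. -/
theorem eq_one_of_pow_eq_one_of_smul_sub_mem {R G : Type*} [CommRing R] [IsDomain R]
    [IsNoetherianRing R] [Group G] [MulSemiringAction G R] [FaithfulSMul G R] {Q : Ideal R}
    [hQ : Q.IsMaximal] {s : G} {N : ℕ} (hN : (N : R) ∉ Q) (hsN : s ^ N = 1)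
    (h1 : ∀ x : R, s • x - x ∈ Q) (h2 : ∀ x ∈ Q, s • x - x ∈ Q ^ 2) : s = 1 := by
  have hpow (i : ℕ) : ∀ x ∈ Q ^ (i + 1), s • x - x ∈ Q ^ (i + 2) := by
    induction i with
    | zero => simpa using h2
    | succ i ih =>
      intro x hx
      rw [pow_succ'] at hx
      induction hx using Submodule.mul_induction_on' with
      | mem_mul_mem a ha b hb =>
        have hsb : s • b ∈ Q ^ (i + 1) := by
          have := add_mem (Ideal.pow_le_pow_right (by lia) (ih b hb)) hb
          simpa using this
        have e : s • (a * b) - a * b = (s • a - a) * (s • b) + a * (s • b - b) := by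
          rw [smul_mul']; ring
        rw [e]
        refine add_mem ?_ ?_
        · have := Ideal.mul_mem_mul (h2 a ha) hsb
          rwa [← pow_add, show 2 + (i + 1) = i + 1 + 2 by lia] at this
        · have := Ideal.mul_mem_mul ha (ih b hb)
          rwa [← pow_succ', show i + 2 + 1 = i + 1 + 2 by lia] at this
      | add a _ b _ ha hb =>
        have := add_mem ha hb
        rwa [smul_add, add_sub_add_comm]
  have hall (i : ℕ) : ∀ x : R, s • x - x ∈ Q ^ (i + 1) := by
    induction i with
    | zero => simpa using h1
    | succ i ih =>
      intro x
      -- Since `s` fixes the class of `s • x - x` in `Q ^ (i + 1) / Q ^ (i + 2)`, the displacement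
      -- of `x` is additive in `j`. At `j = N` it vanishes, and `N` is invertible modulo `Q`.
      have hj (j : ℕ) : s ^ j • x - x - j * (s • x - x) ∈ Q ^ (i + 2) := by
        induction j with
        | zero => simp
        | succ j hj =>
          have hmem : s ^ j • (s • x - x) - (s • x - x) ∈ Q ^ (i + 2) := by
            clear hj
            induction j with
            | zero => simp
            | succ j hj' =>
              have hy : s ^ j • (s • x - x) ∈ Q ^ (i + 1) := by
                have := add_mem (Ideal.pow_le_pow_right (show i + 1 ≤ i + 2 by lia) hj') (ih x)
                simpa using this
              have := add_mem (hpow i _ hy) hj'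
              rw [sub_add_sub_cancel] at this
              rwa [pow_succ' s, mul_smul]
          have := add_mem hmem hj
          convert this using 1
          rw [pow_succ, mul_smul, smul_sub]
          push_cast
          ring
      have hNx := hj N
      rw [hsN, one_smul, sub_self, zero_sub, neg_mem_iff] at hNx
      obtain ⟨a, ha⟩ := hQ.exists_inv hN
      obtain ⟨b, hb, hab⟩ := ha
      have e : s • x - x = a * (N * (s • x - x)) + b * (s • x - x) := by
        rw [← mul_assoc, ← add_mul, hab, one_mul]
      rw [e]
      refine add_mem (Ideal.mul_mem_left _ _ hNx) ?_
      rw [pow_succ' Q (i + 1)]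
      exact Ideal.mul_mem_mul hb (ih x)
  refine FaithfulSMul.eq_of_smul_eq_smul (α := R) fun x ↦ ?_
  -- Krull's intersection theorem turns congruences modulo all powers of `Q` into equality.
  have hbot := Ideal.iInf_pow_eq_bot_of_isDomain Q hQ.ne_top
  have : s • x - x ∈ ⨅ i : ℕ, Q ^ i := by
    rw [Submodule.mem_iInf]
    exact fun i ↦ Ideal.pow_le_pow_right (Nat.le_succ i) (hall i x)
  rw [hbot, Ideal.mem_bot, sub_eq_zero] at this
  rw [this, one_smul]

/-- In a Dedekind domain, a nonzero maximal ideal is principal modulo its square. -/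
theorem exists_mem_forall_mem_exists_sub_mul_mem_sq {R : Type*} [CommRing R] [IsDedekindDomain R]
    {Q : Ideal R} [hQ : Q.IsMaximal] (hQ0 : Q ≠ ⊥) :
    ∃ π ∈ Q, π ∉ Q ^ 2 ∧ ∀ x ∈ Q, ∃ a, x - a * π ∈ Q ^ 2 := by
  have hQ' : Prime Q := Ideal.prime_of_isPrime hQ0 hQ.isPrime
  obtain ⟨π, hπ, hπ2⟩ := SetLike.exists_of_lt (Ideal.pow_right_strictAnti Q hQ0 hQ.ne_top
    (show 1 < 2 by lia))
  replace hπ : π ∈ Q := by simpa using hπ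
  replace hπ2 : π ∉ Q ^ 2 := hπ2
  refine ⟨π, hπ, hπ2, ?_⟩
  have hle : Ideal.span {π} ⊔ Q ^ 2 ≤ Q :=
    sup_le ((Ideal.span_singleton_le_iff_mem _).2 hπ) (Ideal.pow_le_self two_ne_zero)
  have hdvd : Ideal.span {π} ⊔ Q ^ 2 ∣ Q ^ 2 := Ideal.dvd_iff_le.2 le_sup_right
  obtain ⟨i, hi, h⟩ := (dvd_prime_pow hQ' 2).1 hdvd
  have h := associated_iff_eq.1 h
  -- `π ∈ Q` rules out exponent 0, and `π ∉ Q ^ 2` rules out exponent 2.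
  have hi1 : i = 1 := by
    interval_cases i
    · rw [h, pow_zero, Ideal.one_eq_top, top_le_iff] at hle
      exact (hQ.ne_top hle).elim
    · rfl
    · exact (hπ2 (h ▸ Ideal.mem_sup_left (Ideal.mem_span_singleton_self π))).elim
  rw [hi1, pow_one] at h
  intro x hx
  rw [← h, Submodule.mem_sup] at hx
  obtain ⟨y, hy, z, hz, rfl⟩ := hx
  obtain ⟨a, rfl⟩ := Ideal.mem_span_singleton'.1 hy
  exact ⟨a, by simpa using hz⟩

/-- An inertia element of a Dedekind domain that commutes with a Frobenius element and has order
prime to the residue characteristic has order dividing `c - 1`, where the Frobenius is the `c`-th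
power map. -/
theorem pow_sub_one_eq_one_of_commute_frobenius {R G : Type*} [CommRing R] [IsDedekindDomain R]
    [Group G] [MulSemiringAction G R] [FaithfulSMul G R] {Q : Ideal R} [hQ : Q.IsMaximal]
    (hQ0 : Q ≠ ⊥) {s f : G} {N c : ℕ} (hc : 0 < c) (hN : (N : R) ∉ Q) (hsN : s ^ N = 1)
    (hs : ∀ x : R, s • x - x ∈ Q) (hf : ∀ x : R, f • x - x ^ c ∈ Q)
    (hfQ : ∀ x, f • x ∈ Q ↔ x ∈ Q) (hsf : Commute s f) : s ^ (c - 1) = 1 := by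
  obtain ⟨π, hπ, hπ2, hgen⟩ := exists_mem_forall_mem_exists_sub_mul_mem_sq hQ0
  have hsQ (x : R) (hx : x ∈ Q) : s • x ∈ Q := by simpa using add_mem (hs x) hx
  have hsmul_sq (g : G) (hg : ∀ x ∈ Q, g • x ∈ Q) (x : R) (hx : x ∈ Q ^ 2) : g • x ∈ Q ^ 2 := by
    rw [pow_two] at hx ⊢
    induction hx using Submodule.mul_induction_on' with
    | mem_mul_mem a ha b hb => rw [smul_mul']; exact Ideal.mul_mem_mul (hg a ha) (hg b hb)
    | add a _ b _ ha hb => rw [smul_add]; exact add_mem ha hb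
  have hmul_sq {a b : R} (ha : a ∈ Q) (hb : b ∈ Q) : a * b ∈ Q ^ 2 := by
    rw [pow_two]; exact Ideal.mul_mem_mul ha hb
  have hcancel {a : R} (ha : a * π ∈ Q ^ 2) : a ∈ Q := by
    by_contra haQ
    obtain ⟨y, z, hz, hyz⟩ := hQ.exists_inv haQ
    refine hπ2 ?_
    have e : π = y * (a * π) + z * π := by rw [← mul_assoc, ← add_mul, hyz, one_mul]
    rw [e]
    exact add_mem (Ideal.mul_mem_left _ _ ha) (hmul_sq hz hπ)
  -- Modulo `Q`, `u` is the tame character of `s`. As `s` is trivial and `f` is `x ↦ x ^ c` on `R /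
  -- Q`, the two orders of composition send `π` to `v u π` and `u ^ c v π` modulo `Q ^ 2`;
  -- commutation gives `u ^ (c - 1) ≡ 1`.
  obtain ⟨u, hu⟩ := hgen _ (hsQ π hπ)
  obtain ⟨v, hv⟩ := hgen _ ((hfQ π).2 hπ)
  have huQ : u ∉ Q := fun h ↦ hπ2 <| by
    have h' : s • π ∈ Q ^ 2 := by simpa using add_mem hu (hmul_sq h hπ)
    have hinv : ∀ x ∈ Q, s⁻¹ • x ∈ Q := fun x hx ↦ by
      have := sub_mem hx (hs (s⁻¹ • x))
      simpa using this
    simpa using hsmul_sq s⁻¹ hinv _ h'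
  have hvQ : v ∉ Q := fun h ↦ hπ2 <| by
    have h' : f • π ∈ Q ^ 2 := by simpa using add_mem hv (hmul_sq h hπ)
    have hinv : ∀ x ∈ Q, f⁻¹ • x ∈ Q := fun x hx ↦ by
      rw [← hfQ]; simpa using hx
    simpa using hsmul_sq f⁻¹ hinv _ h'
  have h1 : s • (f • π) - v * u * π ∈ Q ^ 2 := by
    have e : s • (f • π) - v * u * π =
        s • (f • π - v * π) + (s • v - v) * (s • π) + v * (s • π - u * π) := by
      rw [smul_sub, smul_mul']; ring
    rw [e]
    exact add_mem (add_mem (hsmul_sq s hsQ _ hv) (hmul_sq (hs v) (hsQ π hπ)))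
      (Ideal.mul_mem_left _ _ hu)
  have h2 : f • (s • π) - u ^ c * v * π ∈ Q ^ 2 := by
    have e : f • (s • π) - u ^ c * v * π =
        f • (s • π - u * π) + (f • u - u ^ c) * (f • π) + u ^ c * (f • π - v * π) := by
      rw [smul_sub, smul_mul']; ring
    rw [e]
    exact add_mem (add_mem (hsmul_sq f (fun x hx ↦ (hfQ x).2 hx) _ hu)
      (hmul_sq (hf u) ((hfQ π).2 hπ))) (Ideal.mul_mem_left _ _ hv)
  have hu1 : u ^ (c - 1) - 1 ∈ Q := by
    have h3 : (v * u * (u ^ (c - 1) - 1)) * π ∈ Q ^ 2 := by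
      have := sub_mem h1 h2
      rw [← mul_smul, ← mul_smul, hsf.eq, sub_sub_sub_cancel_left] at this
      convert this using 1
      obtain ⟨d, rfl⟩ := Nat.exists_eq_succ_of_ne_zero hc.ne'
      simp only [Nat.succ_eq_add_one, Nat.add_sub_cancel]
      ring
    exact ((hQ.isPrime.mem_or_mem (hcancel h3)).resolve_left fun h ↦
      (hQ.isPrime.mem_or_mem h).elim hvQ huQ)
  have hpow1 (j : ℕ) (x : R) : s ^ j • x - x ∈ Q := by
    induction j with
    | zero => simp
    | succ j ih =>
      have := add_mem (hs (s ^ j • x)) ih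
      rwa [sub_add_sub_cancel, ← mul_smul, ← pow_succ'] at this
  have hpowπ (j : ℕ) : s ^ j • π - u ^ j * π ∈ Q ^ 2 := by
    induction j with
    | zero => simp
    | succ j ih =>
      have e : s ^ (j + 1) • π - u ^ (j + 1) * π =
          s • (s ^ j • π - u ^ j * π) + (s • (u ^ j) - u ^ j) * (s • π)
            + u ^ j * (s • π - u * π) := by
        rw [smul_sub, smul_mul', pow_succ', mul_smul]; ring
      rw [e]
      exact add_mem (add_mem (hsmul_sq s hsQ _ ih) (hmul_sq (hs _) (hsQ π hπ)))
        (Ideal.mul_mem_left _ _ hu)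
  refine eq_one_of_pow_eq_one_of_smul_sub_mem hN (by rw [pow_right_comm, hsN, one_pow])
    (hpow1 _) fun x hx ↦ ?_
  obtain ⟨a, ha⟩ := hgen x hx
  have hsQ' : ∀ y ∈ Q, s ^ (c - 1) • y ∈ Q := fun y hy ↦ by simpa using add_mem (hpow1 (c - 1) y) hy
  have e : s ^ (c - 1) • x - x = s ^ (c - 1) • (x - a * π)
      + (s ^ (c - 1) • a - a) * (s ^ (c - 1) • π) + a * (s ^ (c - 1) • π - u ^ (c - 1) * π)
      + a * ((u ^ (c - 1) - 1) * π) - (x - a * π) := by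
    rw [smul_sub, smul_mul']; ring
  rw [e]
  exact sub_mem (add_mem (add_mem (add_mem (hsmul_sq _ hsQ' _ ha)
    (hmul_sq (hpow1 _ a) (hsQ' π hπ))) (Ideal.mul_mem_left _ _ (hpowπ _)))
    (Ideal.mul_mem_left _ _ (hmul_sq hu1 hπ))) ha

/-- Let `M / L` be a finite Galois extension of number fields. A central element of the inertia
group of `Q` whose order is prime to `Q` has order dividing `c - 1`, where `c` is the order of the
residue field of `L` below `Q`. -/
theorem NumberField.pow_card_sub_one_eq_one_of_mem_inertia {L M : Type*} [Field L] [NumberField L]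
    [Field M] [NumberField M] [Algebra L M] [IsGalois L M] {Q : Ideal (𝓞 M)} [hQp : Q.IsPrime]
    (hQ0 : Q ≠ ⊥) {s : Gal(M/L)} {N : ℕ} (hN : (N : 𝓞 M) ∉ Q) (hsN : s ^ N = 1)
    (hs : s ∈ Q.inertia Gal(M/L)) (hcomm : ∀ f : Gal(M/L), Commute s f) :
    s ^ (Nat.card (𝓞 L ⧸ Q.under (𝓞 L)) - 1) = 1 := by
  have : FaithfulSMul Gal(M/L) (𝓞 M) := IsGaloisGroup.faithful (𝓞 L)
  have : Q.IsMaximal := hQp.isMaximal hQ0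
  have : Finite (𝓞 M ⧸ Q) := Ideal.finiteQuotientOfFreeOfNeBot Q hQ0
  obtain ⟨f, hf⟩ := IsArithFrobAt.exists_of_isInvariant (𝓞 L) Gal(M/L) Q
  refine pow_sub_one_eq_one_of_commute_frobenius hQ0 (AlgHom.IsArithFrobAt.card_pos hf) hN hsN
    hs (fun x ↦ hf x) (fun x ↦ ?_) (hcomm f)
  conv_rhs => rw [← AlgHom.IsArithFrobAt.comap_eq hf]
  rfl

/-! ### Congruence subgroups over an ultrametric field -/

section Matrix

variable {K : Type*} [NormedField K] {m : ℕ}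

/-- Ultrametric bound for the entries of a product of matrices. -/
theorem Matrix.norm_mul_apply_le_of_forall_norm_le [IsUltrametricDist K]
    {A B : Matrix (Fin m) (Fin m) K} {a b : ℝ} (ha : 0 ≤ a) (hb : 0 ≤ b)
    (hA : ∀ i j, ‖A i j‖ ≤ a) (hB : ∀ i j, ‖B i j‖ ≤ b) (i j : Fin m) :
    ‖(A * B) i j‖ ≤ a * b := by
  rw [Matrix.mul_apply]
  refine IsUltrametricDist.norm_sum_le_of_forall_le_of_nonneg (mul_nonneg ha hb) fun k _ ↦ ?_
  rw [norm_mul]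
  exact mul_le_mul (hA i k) (hB k j) (norm_nonneg _) ha

/-- The matrices `g` in `GL_m(K)` such that the entries of `g - 1` and of `g⁻¹ - 1` have norm at
most `r`. -/
def Matrix.GeneralLinearGroup.normCongruenceSubgroup [IsUltrametricDist K] (m : ℕ) {r : ℝ}
    (h0 : 0 < r) (h1 : r ≤ 1) : Subgroup (GL (Fin m) K) where
  carrier := {g | (∀ i j, ‖((g : Matrix (Fin m) (Fin m) K) - 1) i j‖ ≤ r) ∧
    ∀ i j, ‖(((g⁻¹ : GL (Fin m) K) : Matrix (Fin m) (Fin m) K) - 1) i j‖ ≤ r}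
  one_mem' := by simp [h0.le]
  inv_mem' := fun ⟨h, h'⟩ ↦ ⟨h', by simpa using h⟩
  mul_mem' := by
    have key (A B : Matrix (Fin m) (Fin m) K) (hA : ∀ i j, ‖(A - 1) i j‖ ≤ r)
        (hB : ∀ i j, ‖(B - 1) i j‖ ≤ r) (i j : Fin m) : ‖(A * B - 1) i j‖ ≤ r := by
      have e : A * B - 1 = (A - 1) * (B - 1) + ((A - 1) + (B - 1)) := by noncomm_ring
      rw [e, Matrix.add_apply, Matrix.add_apply]
      refine (IsUltrametricDist.norm_add_le_max _ _).trans (max_le ?_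
        ((IsUltrametricDist.norm_add_le_max _ _).trans (max_le (hA i j) (hB i j))))
      refine (Matrix.norm_mul_apply_le_of_forall_norm_le h0.le h0.le hA hB i j).trans ?_
      nlinarith
    rintro g h ⟨hg, hg'⟩ ⟨hh, hh'⟩
    refine ⟨fun i j ↦ by simpa using key _ _ hg hh i j, fun i j ↦ ?_⟩
    simpa [mul_inv_rev] using key _ _ hh' hg' i j

namespace Matrix.GeneralLinearGroup

theorem norm_natCast_apply_le (n : ℕ) (i j : Fin m) :
    ‖(n : Matrix (Fin m) (Fin m) K) i j‖ ≤ ‖(n : K)‖ := by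
  rw [← Matrix.diagonal_natCast, Matrix.diagonal_apply]
  split_ifs <;> simp

variable [IsUltrametricDist K] {r : ℝ}

theorem isOpen_normCongruenceSubgroup (h0 : 0 < r) (h1 : r ≤ 1) :
    IsOpen (normCongruenceSubgroup (K := K) m h0 h1 : Set (GL (Fin m) K)) := by
  refine Subgroup.isOpen_of_mem_nhds _ (g := 1) ?_
  have hc (i j : Fin m) : Continuous
      fun g : GL (Fin m) K ↦ ‖((g : Matrix (Fin m) (Fin m) K) - 1) i j‖ :=
    ((Units.continuous_val.sub continuous_const).matrix_elem i j).norm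
  have h (i j : Fin m) : ∀ᶠ g : GL (Fin m) K in nhds 1,
      ‖((g : Matrix (Fin m) (Fin m) K) - 1) i j‖ ≤ r :=
    ((hc i j).tendsto 1).eventually_le_const (by simpa using h0)
  have h' (i j : Fin m) : ∀ᶠ g : GL (Fin m) K in nhds 1,
      ‖(((g⁻¹ : GL (Fin m) K) : Matrix (Fin m) (Fin m) K) - 1) i j‖ ≤ r :=
    (((hc i j).comp continuous_inv).tendsto 1).eventually_le_const (by simpa using h0)
  exact (Filter.eventually_all.2 fun i ↦ Filter.eventually_all.2 (h i)).and
    (Filter.eventually_all.2 fun i ↦ Filter.eventually_all.2 (h' i))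

theorem pow_sub_one_apply_le {A : Matrix (Fin m) (Fin m) K} (h0 : 0 < r) (h1 : r ≤ 1)
    (hA : ∀ i j, ‖(A - 1) i j‖ ≤ r) (n : ℕ) (i j : Fin m) : ‖(A ^ n - 1) i j‖ ≤ r := by
  induction n generalizing i j with
  | zero => simpa using h0.le
  | succ n ih =>
    have e : A ^ (n + 1) - 1 = (A ^ n - 1) * (A - 1) + ((A ^ n - 1) + (A - 1)) := by
      rw [pow_succ]; noncomm_ring
    rw [e, Matrix.add_apply, Matrix.add_apply]
    refine (IsUltrametricDist.norm_add_le_max _ _).trans (max_le ?_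
      ((IsUltrametricDist.norm_add_le_max _ _).trans (max_le (ih i j) (hA i j))))
    refine (Matrix.norm_mul_apply_le_of_forall_norm_le h0.le h0.le ih hA i j).trans ?_
    nlinarith

/-- Every power of `A` is congruent to 1. Used with `A ^ n - 1 = (A - 1) * ∑ A ^ k`, this makes the
`n`-th power act on `A - 1` like multiplication by `n`, up to an error of relative size `r`. -/
theorem geom_sum_sub_natCast_apply_le {A : Matrix (Fin m) (Fin m) K} (h0 : 0 < r) (h1 : r ≤ 1)
    (hA : ∀ i j, ‖(A - 1) i j‖ ≤ r) (n : ℕ) (i j : Fin m) :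
    ‖(∑ k ∈ Finset.range n, A ^ k - (n : Matrix (Fin m) (Fin m) K)) i j‖ ≤ r := by
  have e : ∑ k ∈ Finset.range n, A ^ k - (n : Matrix (Fin m) (Fin m) K) =
      ∑ k ∈ Finset.range n, (A ^ k - 1) := by simp
  rw [e, Matrix.sum_apply]
  exact IsUltrametricDist.norm_sum_le_of_forall_le_of_nonneg h0.le
    fun k _ ↦ pow_sub_one_apply_le h0 h1 hA k i j

/-- If `A ≡ 1` modulo `r`, then `A ^ n ≡ 1` modulo `r ^ 2` and `n r`. -/
theorem pow_sub_one_apply_le_mul_max {A : Matrix (Fin m) (Fin m) K} (h0 : 0 < r) (h1 : r ≤ 1)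
    (hA : ∀ i j, ‖(A - 1) i j‖ ≤ r) (n : ℕ) (i j : Fin m) :
    ‖(A ^ n - 1) i j‖ ≤ r * max r ‖(n : K)‖ := by
  rw [← mul_geom_sum]
  refine Matrix.norm_mul_apply_le_of_forall_norm_le h0.le (h0.le.trans (le_max_left _ _)) hA
    (fun i j ↦ ?_) i j
  have := IsUltrametricDist.norm_add_le_max
    ((∑ k ∈ Finset.range n, A ^ k - (n : Matrix (Fin m) (Fin m) K)) i j)
    ((n : Matrix (Fin m) (Fin m) K) i j)
  rw [← Matrix.add_apply, sub_add_cancel] at this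
  exact this.trans (max_le_max (geom_sum_sub_natCast_apply_le h0 h1 hA n i j)
    (norm_natCast_apply_le n i j))

/-- A matrix close to `1` whose `n`-th power is `1` equals `1`, when `n` is not too small. -/
theorem eq_one_of_pow_eq_one_of_lt {A : Matrix (Fin m) (Fin m) K} (h0 : 0 < r) (h1 : r ≤ 1)
    (hA : ∀ i j, ‖(A - 1) i j‖ ≤ r) {n : ℕ} (hn : r < ‖(n : K)‖) (hAn : A ^ n = 1) : A = 1 := by
  rcases isEmpty_or_nonempty (Fin m) with hm | hm
  · exact Subsingleton.elim _ _
  -- At an entry of `A - 1` of largest norm, `n (A - 1) = -(A - 1) B` gives `‖n‖ * max ≤ max * r`,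
  -- so the maximum is 0.
  obtain ⟨⟨a, b⟩, hab⟩ := Finite.exists_max fun x : Fin m × Fin m ↦ ‖(A - 1) x.1 x.2‖
  set B := ∑ k ∈ Finset.range n, A ^ k - (n : Matrix (Fin m) (Fin m) K) with hB
  have hzero : (A - 1) * B = - ((n : Matrix (Fin m) (Fin m) K) * (A - 1)) := by
    rw [hB, mul_sub, mul_geom_sum, hAn, sub_self, zero_sub, Nat.cast_comm]
  have hle := Matrix.norm_mul_apply_le_of_forall_norm_le (norm_nonneg _) h0.le
    (fun i j ↦ hab (i, j)) (geom_sum_sub_natCast_apply_le h0 h1 hA n) a b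
  rw [← hB, hzero, Matrix.neg_apply, norm_neg, ← nsmul_eq_mul, Matrix.smul_apply, nsmul_eq_mul,
    norm_mul] at hle
  have hab0 : ‖(A - 1) a b‖ = 0 := by
    have := norm_nonneg ((A - 1) a b)
    simp only at hle
    nlinarith
  rw [← sub_eq_zero]
  ext i j
  have := hab (i, j)
  simp only [hab0] at this
  simpa using le_antisymm this (norm_nonneg _)

theorem eq_one_of_forall_mem_normCongruenceSubgroup {g : GL (Fin m) K}
    (hg : ∀ (r : ℝ) (h0 : 0 < r) (h1 : r ≤ 1), g ∈ normCongruenceSubgroup m h0 h1) : g = 1 := by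
  refine Units.ext (sub_eq_zero.1 ?_)
  ext i j
  rw [Matrix.zero_apply, ← norm_le_zero_iff]
  refine le_of_forall_gt_imp_ge_of_dense fun ε hε ↦ ?_
  exact ((hg (min ε 1) (lt_min hε one_pos) (min_le_right _ _)).1 i j).trans (min_le_left _ _)

end Matrix.GeneralLinearGroup

end Matrix

/-! ### Torsion and `p`-power maps in `p`-adic congruence subgroups -/

section Padic

variable {p : ℕ} [Fact p.Prime] {K : Type*} [NormedField K] [NormedAlgebra ℚ_[p] K] {m : ℕ}

theorem Padic.norm_natCast_normedAlgebra (n : ℕ) : ‖(n : K)‖ = ‖(n : ℚ_[p])‖ := by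
  rw [← map_natCast (algebraMap ℚ_[p] K), norm_algebraMap']

theorem Padic.isUltrametricDist_normedAlgebra (p : ℕ) [Fact p.Prime] (K : Type*) [NormedField K]
    [NormedAlgebra ℚ_[p] K] : IsUltrametricDist K :=
  IsUltrametricDist.isUltrametricDist_of_forall_norm_natCast_le_one fun n ↦ by
    rw [Padic.norm_natCast_normedAlgebra (p := p)]
    exact_mod_cast Padic.norm_int_le_one (p := p) n

/-- A prime other than `p` is a `p`-adic unit. Hence a radius below `1/p` is smaller than the norm
of every prime, which lets torsion be removed one prime at a time. -/
theorem Padic.inv_le_norm_natCast_of_prime {q : ℕ} (hq : q.Prime) : (p : ℝ)⁻¹ ≤ ‖(q : ℚ_[p])‖ := by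
  by_cases h : q = p
  · rw [h, Padic.norm_p]
  · rw [Padic.norm_natCast_eq_one_iff.2
      ((Nat.coprime_primes Fact.out hq).2 (Ne.symm h))]
    exact inv_le_one_of_one_le₀ (by exact_mod_cast (Fact.out : p.Prime).one_lt.le)

namespace Matrix.GeneralLinearGroup

variable [IsUltrametricDist K] {r : ℝ}

/-- Small congruence subgroups of `GL_m(K)` are torsion-free. -/
theorem eq_one_of_pow_eq_one_of_mem_normCongruenceSubgroup {h0 : 0 < r} {h1 : r ≤ 1}
    (hr : r < (p : ℝ)⁻¹) {n : ℕ} (hn : n ≠ 0) {g : GL (Fin m) K}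
    (hg : g ∈ normCongruenceSubgroup m h0 h1) (hgn : g ^ n = 1) : g = 1 := by
  induction n using induction_on_primes generalizing g with
  | zero => exact (hn rfl).elim
  | one => simpa using hgn
  | prime_mul q a hq ih =>
    rw [mul_comm, pow_mul] at hgn
    have ha : a ≠ 0 := right_ne_zero_of_mul hn
    refine ih ha hg (Units.ext ?_)
    refine eq_one_of_pow_eq_one_of_lt h0 h1 (pow_mem hg a).1 (n := q) ?_ ?_
    · rw [Padic.norm_natCast_normedAlgebra (p := p)]
      exact hr.trans_le (Padic.inv_le_norm_natCast_of_prime hq)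
    · rw [← Units.val_pow_eq_pow_val, hgn, Units.val_one]

/-- Small congruence subgroups of `GL_m(K)` are pro-`p`. -/
theorem exists_pow_prime_pow_mem_normCongruenceSubgroup {h0 : 0 < r} {h1 : r ≤ 1}
    (hr : r < (p : ℝ)⁻¹) {g : GL (Fin m) K} (hg : g ∈ normCongruenceSubgroup m h0 h1)
    {r' : ℝ} (h0' : 0 < r') (h1' : r' ≤ 1) :
    ∃ k : ℕ, g ^ p ^ k ∈ normCongruenceSubgroup m h0' h1' := by
  have hp : (p : ℝ)⁻¹ < 1 :=
    inv_lt_one_of_one_lt₀ (by exact_mod_cast (Fact.out : p.Prime).one_lt)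
  have hp0 : 0 < (p : ℝ)⁻¹ := inv_pos.2 (by exact_mod_cast (Fact.out : p.Prime).pos)
  -- Each `p`-th power gains a factor `‖p‖ = 1/p`, since the current radius is already at most
  -- `1/p`.
  have key (A : Matrix (Fin m) (Fin m) K) (hA : ∀ i j, ‖(A - 1) i j‖ ≤ r) (k : ℕ) :
      ∀ i j, ‖(A ^ p ^ k - 1) i j‖ ≤ (p : ℝ)⁻¹ ^ (k + 1) := by
    induction k with
    | zero => exact fun i j ↦ by simpa using (hA i j).trans hr.le
    | succ k ih =>
      intro i j
      have := pow_sub_one_apply_le_mul_max (pow_pos hp0 _)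
        (pow_le_one₀ hp0.le hp.le) ih p i j
      rw [← pow_mul, ← pow_succ, Padic.norm_natCast_normedAlgebra (p := p), Padic.norm_p,
        max_eq_right (pow_le_of_le_one hp0.le hp.le (Nat.succ_ne_zero k)), ← pow_succ] at this
      exact this
  obtain ⟨k, hk⟩ := exists_pow_lt_of_lt_one h0' hp
  have hk' : (p : ℝ)⁻¹ ^ (k + 1) ≤ r' :=
    (pow_le_pow_of_le_one hp0.le hp.le (Nat.le_succ k)).trans hk.le
  refine ⟨k, fun i j ↦ ?_, fun i j ↦ ?_⟩
  · simpa using (key _ hg.1 k i j).trans hk'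
  · rw [← inv_pow]
    simpa using (key _ hg.2 k i j).trans hk'

end Matrix.GeneralLinearGroup

end Padic

/-! ### Inertia groups and finite layers -/

theorem NumberField.RingOfIntegers.coe_smul_algEquiv {k F : Type*} [Field k] [Field F]
    [Algebra k F] (g : Gal(F/k)) (x : 𝓞 F) : ((g • x : 𝓞 F) : F) = g (x : F) :=
  algebraMap.smul' g x F

/-- Inertia restricts to inertia. -/
theorem restrictNormalHom_mem_inertia {L : Type*} [Field L] {Ω : Type*} [Field Ω] [Algebra L Ω]
    (M : IntermediateField L Ω) [Normal L M] {Q : Ideal (𝓞 Ω)} {σ : Gal(Ω/L)}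
    (hσ : σ ∈ Q.inertia Gal(Ω/L)) :
    AlgEquiv.restrictNormalHom M σ ∈ (Q.under (𝓞 M)).inertia Gal(M/L) := by
  intro x
  have h := hσ (algebraMap (𝓞 M) (𝓞 Ω) x)
  change _ ∈ Q at h
  change algebraMap (𝓞 M) (𝓞 Ω) (AlgEquiv.restrictNormalHom M σ • x - x) ∈ Q
  convert h using 1
  rw [map_sub]
  congr 1
  apply NumberField.RingOfIntegers.ext
  rw [NumberField.RingOfIntegers.coe_smul_algEquiv]
  have := AlgEquiv.restrictNormalHom_apply M σ (x : M)
  rw [← NumberField.RingOfIntegers.coe_smul_algEquiv] at this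
  exact this

theorem NumberField.finite_setOf_mem_asIdeal {L : Type*} [Field L] [NumberField L] {x : 𝓞 L}
    (hx : x ≠ 0) : {q : IsDedekindDomain.HeightOneSpectrum (𝓞 L) | x ∈ q.asIdeal}.Finite := by
  have h : Ideal.span {x} ≠ ⊥ := by simpa using hx
  refine (Ideal.finite_factors h).subset fun q hq ↦ ?_
  rw [Set.mem_ofPred_eq, Ideal.dvd_span_singleton]
  exact hq

/-- Only finitely many primes have a nontrivial inertia group in a given finite extension. -/
theorem NumberField.finite_setOf_inertia_ne_bot (L M : Type*) [Field L] [NumberField L] [Field M]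
    [NumberField M] [Algebra L M] [IsGalois L M] :
    {q : IsDedekindDomain.HeightOneSpectrum (𝓞 L) | ∃ Q : Ideal (𝓞 M), Q.LiesOver q.asIdeal ∧
      Q.inertia Gal(M/L) ≠ ⊥}.Finite := by
  have : FaithfulSMul Gal(M/L) (𝓞 M) := IsGaloisGroup.faithful (𝓞 L)
  have hmove (s : Gal(M/L)) (hs : s ≠ 1) : ∃ x : 𝓞 M, s • x - x ≠ 0 := by
    by_contra! h
    exact hs (FaithfulSMul.eq_of_smul_eq_smul fun x : 𝓞 M ↦ by
      rw [one_smul, sub_eq_zero.1 (h x)])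
  have hbelow (s : Gal(M/L)) (hs : s ≠ 1) : ∃ y : 𝓞 L, y ≠ 0 ∧ ∀ Q : Ideal (𝓞 M),
      s ∈ Q.inertia Gal(M/L) → algebraMap (𝓞 L) (𝓞 M) y ∈ Q := by
    obtain ⟨x, hx⟩ := hmove s hs
    -- An ideal with `s` in its inertia contains `s • x - x`; by integrality this nonzero element
    -- has a nonzero multiple in `𝓞 L`, which lies in only finitely many primes.
    have hne : (Ideal.span {s • x - x}).under (𝓞 L) ≠ ⊥ :=
      Ideal.comap_ne_bot_of_integral_mem hx (Ideal.mem_span_singleton_self _)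
        (Algebra.IsIntegral.isIntegral _)
    obtain ⟨y, hy, hy0⟩ := Submodule.exists_mem_ne_zero_of_ne_bot hne
    refine ⟨y, hy0, fun Q hQ ↦ ?_⟩
    exact (Ideal.span_singleton_le_iff_mem _).2 (hQ x) hy
  choose! y hy0 hy using hbelow
  refine (Set.finite_iUnion fun s : {s : Gal(M/L) // s ≠ 1} ↦
    finite_setOf_mem_asIdeal (hy0 s.1 s.2)).subset ?_
  rintro q ⟨Q, hQ, hne⟩
  obtain ⟨s, hs, hs1⟩ := (Subgroup.bot_or_exists_ne_one (Q.inertia Gal(M/L))).resolve_left hne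
  refine Set.mem_iUnion.2 ⟨⟨s, hs1⟩, ?_⟩
  rw [Set.mem_ofPred_eq, hQ.over]
  exact hy s hs1 Q hs

/-- Open normal subgroups of an infinite Galois group correspond to finite Galois extensions. -/
theorem InfiniteGalois.exists_finite_isGalois_fixingSubgroup_eq {k Ω : Type*} [Field k] [Field Ω]
    [Algebra k Ω] [IsGalois k Ω] {W : Subgroup Gal(Ω/k)} (hW : IsOpen (W : Set Gal(Ω/k)))
    (hn : W.Normal) : ∃ M : IntermediateField k Ω, FiniteDimensional k M ∧ IsGalois k M ∧
      M.fixingSubgroup = W := by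
  have h : (IntermediateField.fixedField W).fixingSubgroup = W :=
    fixingSubgroup_fixedField ⟨W, Subgroup.isClosed_of_isOpen W hW⟩
  have h2 := isOpen_and_normal_iff_finite_and_isGalois (IntermediateField.fixedField W)
  rw [h] at h2
  obtain ⟨h3, h4⟩ := h2.1 ⟨hW, hn⟩
  exact ⟨_, h3, h4, h⟩

/-! ### Finiteness of ramification -/

open Matrix.GeneralLinearGroup in
/-- A continuous `p`-adic representation with abelian image is ramified at finitely many primes;
semisimplicity is not needed. -/
theorem finite_setOf_not_isUnramifiedAt_of_commute {L : Type*} [Field L] [NumberField L]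
    {p : ℕ} [Fact p.Prime]
    {K : Type*} [NormedField K] [NormedAlgebra ℚ_[p] K]
    {m : ℕ} (ρ : AbsGal L →ₜ* GL (Fin m) K)
    (hab : ∀ g h : AbsGal L, Commute (ρ g) (ρ h)) :
    {q : IsDedekindDomain.HeightOneSpectrum (𝓞 L) |
      ¬ IsUnramifiedAt (ρ : AbsGal L →* GL (Fin m) K) q}.Finite := by
  have : IsUltrametricDist K := Padic.isUltrametricDist_normedAlgebra p K
  have hfield {r : ℝ} (h0 : 0 < r) (h1 : r ≤ 1) :
      ∃ M : IntermediateField L (AlgebraicClosure L), NumberField M ∧ IsGalois L M ∧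
        ∀ σ, σ ∈ M.fixingSubgroup ↔ ρ σ ∈ normCongruenceSubgroup m h0 h1 := by
    obtain ⟨M, hfin, hgal, hM⟩ := InfiniteGalois.exists_finite_isGalois_fixingSubgroup_eq
      (W := (normCongruenceSubgroup m h0 h1).comap (ρ : AbsGal L →* GL (Fin m) K))
      ((isOpen_normCongruenceSubgroup h0 h1).preimage ρ.continuous_toFun)
      -- The preimage is normal because the image of `ρ` is abelian: conjugation does not change `ρ
      -- g`.
      ⟨fun g hg σ ↦ by
        have e : ρ (σ * g * σ⁻¹) = ρ g := by
          rw [map_mul, map_mul, (hab σ g).eq, mul_assoc, ← map_mul, mul_inv_cancel, map_one,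
            mul_one]
        have hg' : ρ g ∈ normCongruenceSubgroup m h0 h1 := hg
        rw [← e] at hg'
        exact hg'⟩
    exact ⟨M, NumberField.of_module_finite L M, hgal, fun σ ↦ by rw [hM]; rfl⟩
  have hp1 : 1 < (p : ℝ) := by exact_mod_cast (Fact.out : p.Prime).one_lt
  -- Any positive radius below `1/p` would serve.
  have hr0 : 0 < (p : ℝ)⁻¹ / 2 := by positivity
  have hr : (p : ℝ)⁻¹ / 2 < (p : ℝ)⁻¹ := half_lt_self (by positivity)
  have hr1 : (p : ℝ)⁻¹ / 2 ≤ 1 := hr.le.trans (inv_le_one_of_one_le₀ hp1.le)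
  obtain ⟨L', _, _, hL'⟩ := hfield hr0 hr1
  have hp0 : (p : 𝓞 L) ≠ 0 := Nat.cast_ne_zero.2 (Fact.out : p.Prime).ne_zero
  refine ((NumberField.finite_setOf_mem_asIdeal hp0).union
    (NumberField.finite_setOf_inertia_ne_bot L L')).subset fun q hq ↦ ?_
  by_contra hq'
  obtain ⟨hqp, hqL'⟩ := not_or.1 hq'
  refine hq fun Q hQp hQ σ hσ ↦ ?_
  have hover (M : IntermediateField L (AlgebraicClosure L)) :
      (Q.under (𝓞 M)).under (𝓞 L) = q.asIdeal := by
    rw [Ideal.under_under, hQ.over]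
  have hσr : ρ σ ∈ normCongruenceSubgroup m hr0 hr1 := by
    have hbot : (Q.under (𝓞 L')).inertia Gal(L'/L) = ⊥ := by
      by_contra h
      exact hqL' ⟨_, ⟨(hover L').symm⟩, h⟩
    have := restrictNormalHom_mem_inertia L' hσ
    rw [hbot, Subgroup.mem_bot, ← MonoidHom.mem_ker,
      IntermediateField.restrictNormalHom_ker] at this
    exact (hL' σ).1 this
  have hfin : Finite (𝓞 L ⧸ q.asIdeal) := Ideal.finiteQuotientOfFreeOfNeBot _ q.ne_bot
  have hcard : 1 < Nat.card (𝓞 L ⧸ q.asIdeal) := by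
    have : Nontrivial (𝓞 L ⧸ q.asIdeal) := Ideal.Quotient.nontrivial_iff.2 q.isPrime.ne_top
    exact Finite.one_lt_card
  -- Torsion-freeness reduces the goal to `ρ σ ^ (c - 1) = 1`, with `c - 1 ≠ 0`; that equality is
  -- tested in every congruence subgroup.
  refine eq_one_of_pow_eq_one_of_mem_normCongruenceSubgroup hr
    (n := Nat.card (𝓞 L ⧸ q.asIdeal) - 1) (by lia) hσr
    (eq_one_of_forall_mem_normCongruenceSubgroup fun r h0 h1 ↦ ?_)
  obtain ⟨M, _, _, hM⟩ := hfield h0 h1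
  obtain ⟨k, hk⟩ := exists_pow_prime_pow_mem_normCongruenceSubgroup hr hσr h0 h1
  have hrestrict (τ : AbsGal L) : AlgEquiv.restrictNormalHom M τ = 1 ↔
      ρ τ ∈ normCongruenceSubgroup m h0 h1 := by
    rw [← MonoidHom.mem_ker, IntermediateField.restrictNormalHom_ker, hM]
  have hQM0 : Q.under (𝓞 M) ≠ ⊥ := fun h ↦ q.ne_bot <| by
    rw [← hover M, h, Ideal.under_bot]
  -- Tameness: `σ` has order dividing `p ^ k` on `M`, and `p ∉ q`.
  have hpk : ((p ^ k : ℕ) : 𝓞 M) ∉ Q.under (𝓞 M) := fun h ↦ hqp <| by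
    rw [Nat.cast_pow] at h
    have := (inferInstance : (Q.under (𝓞 M)).IsPrime).mem_of_pow_mem _ h
    rw [Set.mem_ofPred_eq, ← hover M, Ideal.mem_comap, map_natCast]
    exact this
  have hpow := NumberField.pow_card_sub_one_eq_one_of_mem_inertia hQM0 hpk
    (by rw [← map_pow, hrestrict, map_pow]; exact hk) (restrictNormalHom_mem_inertia M hσ)
    fun f ↦ by
      obtain ⟨φ, rfl⟩ := AlgEquiv.restrictNormalHom_surjective (AlgebraicClosure L) f
      -- `Gal(M/L)` is abelian because `ρ` kills commutators of lifts.
      rw [← commutatorElement_eq_one_iff_commute, ← map_commutatorElement, hrestrict,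
        map_commutatorElement, commutatorElement_eq_one_iff_commute.2 (hab σ φ)]
      exact one_mem _
  rw [hover M, ← map_pow, hrestrict, map_pow] at hpow
  exact hpow

theorem corollary3 {L : Type*} [Field L] [NumberField L]
    {p : ℕ} [Fact p.Prime]
    {K : Type*} [NormedField K] [NormedAlgebra ℚ_[p] K] [FiniteDimensional ℚ_[p] K]
    {m : ℕ} (ρ : AbsGal L →ₜ* GL (Fin m) K)
    (hss : (linearRep (ρ : AbsGal L →* GL (Fin m) K)).IsSemisimpleRepresentation)
    (hab : ∀ g h : AbsGal L, Commute (ρ g) (ρ h)) :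
    {q : IsDedekindDomain.HeightOneSpectrum (𝓞 L) |
      ¬ IsUnramifiedAt (ρ : AbsGal L →* GL (Fin m) K) q}.Finite :=
  finite_setOf_not_isUnramifiedAt_of_commute (p := p) ρ hab
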